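/- Let $G=(V,E)$ be a finite simple graph on $n$ vertices with at least one edge and minimum degree $\delta$, and let $0=\mu_1\le\mu_2\le\dots\le\mu_n$ be the eigenvalues (with multiplicity) of its Laplacian matrix $L=D-A$. For $S\subseteq V$ let $G-S$ be the subgraph induced by $V\setminus S$ and $c(G-S)$ its number of connected components. The toughness of $G$ is $t(G)=\min |S|/c(G-S)$, the minimum being over all $S\subset V$ with $c(G-S)>1$; if $G$ is complete, $t(G)=\infty$. Let $S\subsetneq V$ be such that $t(G)=|S|/c(G-S)$ (no such $S$ is needed in case (i)). Then $\mu_n>\delta$, and $$t(G)\ \ge\ \frac{\mu_2}{\mu_n-\delta}$$ holds in each of the following cases: (i) the complement of $G$ is disconnected; (ii) every connected component of $G-S$ is a single vertex; (iii) the union of some connected components of $G-S$ has exactly $\frac12(n-|S|)$ vertices; (iv) $c(G-S)=2$. -/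

import Mathlib

namespace LaplacianToughness

/-- The graph `G - S`: the subgraph of `G` induced on the complement of `S`. -/
abbrev deleteSet {V : Type*} (G : SimpleGraph V) (S : Set V) : SimpleGraph ↥(Sᶜ) :=
  G.induce Sᶜ

/-- `c(G - S)`, the number of connected components of `G - S`. -/
noncomputable def numComponents {V : Type*} (G : SimpleGraph V) (S : Set V) : ℕ :=
  Nat.card (deleteSet G S).ConnectedComponent

/-- The toughness `t(G)`: the minimum of `|S| / c(G - S)` over all `S` with `c(G - S) > 1`.
For a finite graph only finitely many sets `S` occur, so the infimum is a minimum unless there is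
no such `S`, that is, unless `G` is complete; then it is `⊤`. -/
noncomputable def toughness {V : Type*} (G : SimpleGraph V) : EReal :=
  ⨅ S : {S : Set V // 1 < numComponents G S},
    (((S.1.ncard : ℝ) / (numComponents G S.1 : ℝ) : ℝ) : EReal)

/-- The Laplacian matrix `D - A` is Hermitian. -/
theorem isHermitian_lapMatrix {V : Type*} [Fintype V] [DecidableEq V] (G : SimpleGraph V)
    [DecidableRel G.Adj] : (G.lapMatrix ℝ).IsHermitian :=
  (G.posSemidef_lapMatrix ℝ).isHermitian

/-- `μ_i(G)` for `1 ≤ i ≤ n`: the `i`-th smallest eigenvalue, with multiplicity, of the Laplacian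
matrix of `G`. Mathlib's `eigenvalues₀` lists the eigenvalues in decreasing order, indexed from 0.
The value is 0 outside the range `1 ≤ i ≤ n`. -/
noncomputable def lapEigenvalue {V : Type*} [Fintype V] [DecidableEq V] (G : SimpleGraph V)
    [DecidableRel G.Adj] (i : ℕ) : ℝ :=
  if h : 1 ≤ i ∧ i ≤ Fintype.card V then
    (isHermitian_lapMatrix G).eigenvalues₀ ⟨Fintype.card V - i, by omega⟩
  else 0

end LaplacianToughness

namespace LaplacianToughness

open Matrix Finset

variable {V : Type*} [Fintype V] [DecidableEq V] (G : SimpleGraph V) [DecidableRel G.Adj]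

/-! Write e(A) for the number of edges leaving A (`cutForm`) and c for c(G-S). The target is c μ₂ ≤
|S| (μₙ - δ). Spectrally, a quadratic polynomial nonnegative on [μ₂, μₙ] is nonnegative at L on
zero-sum vectors; it is applied to combinations of indicator vectors.

Two bounds recur. One representative per component gives an independent set, and the Hoffman bound
then says c μₙ ≤ n (μₙ - δ). The zero-sum vector |B| 1_A - |A| 1_B, with no edges between A and B,
bounds μ₂ by e(A) and e(B). In (i), μₙ ≥ n gives c ≤ n - δ ≤ μₙ - δ, while μ₂ ≤ |S| for any cut. In
(ii), V \ S is independent and μ₂ ≤ δ. In (iii), equal halves give n μ₂ ≤ |S| μₙ, to be combined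
with the Hoffman bound.

Case (iv) is the hard one (`two_mul_lapEigenvalue_two_le_of_cut`). If 2μ₂ > |S| (μₙ - δ), then (μₙ -
L)(L - μ₂) ≥ 0 with Cauchy–Schwarz (`cutForm_sq_le`) forces e(C) < μ₂ |C| on both sides C of the
cut, contradicting the test vector above. -/

/-! ### Spectral inequalities on zero-sum vectors. -/

theorem sum_eigenvectorBasis_mul {M : Matrix V V ℝ} (hM : M.IsHermitian) (x y : V → ℝ) :
    ∑ i, (⇑(hM.eigenvectorBasis i) ⬝ᵥ x) * (⇑(hM.eigenvectorBasis i) ⬝ᵥ y) = x ⬝ᵥ y := by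
  have h := hM.eigenvectorBasis.sum_inner_mul_inner (WithLp.toLp 2 x) (WithLp.toLp 2 y)
  simp only [EuclideanSpace.inner_eq_star_dotProduct, star_trivial] at h
  rw [dotProduct_comm x y, ← h]
  refine Finset.sum_congr rfl fun i _ => ?_
  rw [dotProduct_comm y]

theorem eigenvectorBasis_dotProduct_mulVec {M : Matrix V V ℝ} (hM : M.IsHermitian) (x : V → ℝ)
    (i : V) : ⇑(hM.eigenvectorBasis i) ⬝ᵥ (M *ᵥ x)
      = hM.eigenvalues i * (⇑(hM.eigenvectorBasis i) ⬝ᵥ x) := by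
  have hT : Mᵀ = M := by simpa using hM.eq
  rw [dotProduct_mulVec, ← mulVec_transpose, hT, hM.mulVec_eigenvectorBasis, smul_dotProduct,
    smul_eq_mul]

theorem lapMatrix_dotProduct_comm (x y : V → ℝ) :
    x ⬝ᵥ (G.lapMatrix ℝ *ᵥ y) = (G.lapMatrix ℝ *ᵥ x) ⬝ᵥ y := by
  rw [dotProduct_mulVec, ← mulVec_transpose, (G.isSymm_lapMatrix (R := ℝ)).eq]

theorem lapMatrix_eigenvalues_nonneg (i : V) : 0 ≤ (isHermitian_lapMatrix G).eigenvalues i :=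
  (G.posSemidef_lapMatrix ℝ).eigenvalues_nonneg i

theorem lapEigenvalue_nonneg (i : ℕ) : 0 ≤ lapEigenvalue G i := by
  unfold lapEigenvalue
  split_ifs with h
  · have := lapMatrix_eigenvalues_nonneg G
      ((Fintype.equivOfCardEq (Fintype.card_fin _)) ⟨Fintype.card V - i, by omega⟩)
    simpa [Matrix.IsHermitian.eigenvalues] using this
  · exact le_rfl

theorem eigenvalues_le_lapEigenvalue_card (i : V) :
    (isHermitian_lapMatrix G).eigenvalues i ≤ lapEigenvalue G (Fintype.card V) := by
  have : 0 < Fintype.card V := Fintype.card_pos_iff.2 ⟨i⟩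
  rw [lapEigenvalue, dif_pos (by omega)]
  refine (isHermitian_lapMatrix G).eigenvalues₀_antitone ?_
  rw [Fin.le_def]
  simp

/-- All but one of the Laplacian eigenvalues are at least `μ₂`. -/
theorem exists_forall_ne_lapEigenvalue_two_le (hn : 2 ≤ Fintype.card V) :
    ∃ i₀ : V, ∀ i, i ≠ i₀ → lapEigenvalue G 2 ≤ (isHermitian_lapMatrix G).eigenvalues i := by
  -- The last index of the decreasing list carries μ₁; the equivalence is the one that `eigenvalues`
  -- uses to reindex `eigenvalues₀` by `V`.
  refine ⟨Fintype.equivOfCardEq (Fintype.card_fin _) ⟨Fintype.card V - 1, by omega⟩,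
    fun i hi => ?_⟩
  rw [lapEigenvalue, dif_pos (by omega)]
  refine (isHermitian_lapMatrix G).eigenvalues₀_antitone ?_
  rw [Ne, ← Equiv.symm_apply_eq, Fin.ext_iff] at hi
  rw [Fin.le_def]
  have := ((Fintype.equivOfCardEq (Fintype.card_fin (Fintype.card V))).symm i).2
  simp only at hi ⊢
  omega

/-- On vectors with zero sum, only eigenvalues in `[μ₂, μₙ]` contribute. -/
theorem dotProduct_eq_zero_or_lapEigenvalue_two_le (hn : 2 ≤ Fintype.card V) {x : V → ℝ}
    (hx : ∑ v, x v = 0) (i : V) :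
    ⇑((isHermitian_lapMatrix G).eigenvectorBasis i) ⬝ᵥ x = 0 ∨
      lapEigenvalue G 2 ≤ (isHermitian_lapMatrix G).eigenvalues i := by
  obtain ⟨i₀, hi₀⟩ := exists_forall_ne_lapEigenvalue_two_le G hn
  rcases (lapEigenvalue_nonneg G 2).eq_or_lt with h0 | hpos
  · exact .inr (h0 ▸ lapMatrix_eigenvalues_nonneg G i)
  by_cases hi : i = i₀
  swap
  · exact .inr (hi₀ i hi)
  subst hi
  left
  have hM := isHermitian_lapMatrix G
  -- With μ₂ > 0, every eigenvector but the `i`-th has nonzero eigenvalue and so is orthogonal to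
  -- constants. By Parseval the `i`-th one carries all of the constant vector, hence is orthogonal
  -- to `x`.
  have hone : ∀ j, j ≠ i → ⇑(hM.eigenvectorBasis j) ⬝ᵥ (fun _ => (1 : ℝ)) = 0 := by
    intro j hj
    have h := eigenvectorBasis_dotProduct_mulVec hM (fun _ => (1 : ℝ)) j
    rw [G.lapMatrix_mulVec_const_eq_zero, dotProduct_zero] at h
    have := hpos.trans_le (hi₀ j hj)
    exact (mul_eq_zero.1 h.symm).resolve_left this.ne'
  have key : ∀ y : V → ℝ, (⇑(hM.eigenvectorBasis i) ⬝ᵥ (fun _ => (1 : ℝ))) *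
      (⇑(hM.eigenvectorBasis i) ⬝ᵥ y) = (fun _ => (1 : ℝ)) ⬝ᵥ y := by
    intro y
    rw [← sum_eigenvectorBasis_mul hM (fun _ => (1 : ℝ)) y]
    symm
    apply Fintype.sum_eq_single
    intro j hj
    rw [hone j hj, zero_mul]
  have h1 := key (fun _ => 1)
  have h2 := key x
  have hn' : (0 : ℝ) < Fintype.card V := by exact_mod_cast (by omega : 0 < Fintype.card V)
  simp only [dotProduct, one_mul, mul_one, hx, Finset.sum_const, Finset.card_univ,
    nsmul_eq_mul] at h1 h2
  rcases mul_eq_zero.1 h2 with h | h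
  · rw [h] at h1
    linarith
  · exact h

/-- A quadratic polynomial which is nonnegative on `[μ₂, μₙ]` is nonnegative at the Laplacian,
after projecting to vectors with zero sum. -/
theorem lapMatrix_polynomial_nonneg (hn : 2 ≤ Fintype.card V) {p q r : ℝ}
    (h : ∀ t, lapEigenvalue G 2 ≤ t → t ≤ lapEigenvalue G (Fintype.card V) →
      0 ≤ p + q * t + r * t ^ 2) (x : V → ℝ) :
    0 ≤ p * (x ⬝ᵥ x - (∑ v, x v) ^ 2 / Fintype.card V) + q * (x ⬝ᵥ (G.lapMatrix ℝ *ᵥ x))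
      + r * ((G.lapMatrix ℝ *ᵥ x) ⬝ᵥ (G.lapMatrix ℝ *ᵥ x)) := by
  have hn' : (0 : ℝ) < Fintype.card V := by exact_mod_cast (by omega : 0 < Fintype.card V)
  have hM := isHermitian_lapMatrix G
  set m : ℝ := (∑ v, x v) / Fintype.card V with hm
  -- Projection to zero sum: `L` kills constants, so only the squared norm changes.
  set y : V → ℝ := x - m • (fun _ => (1 : ℝ)) with hy
  have hsum : ∑ v, y v = 0 := by
    simp only [hy, Pi.sub_apply, Pi.smul_apply, smul_eq_mul, mul_one, Finset.sum_sub_distrib,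
      Finset.sum_const, Finset.card_univ, nsmul_eq_mul, hm]
    field_simp
    ring
  have hLy : G.lapMatrix ℝ *ᵥ y = G.lapMatrix ℝ *ᵥ x := by
    rw [hy, mulVec_sub, mulVec_smul, G.lapMatrix_mulVec_const_eq_zero]
    simp
  have hyy : y ⬝ᵥ y = x ⬝ᵥ x - (∑ v, x v) ^ 2 / Fintype.card V := by
    have h1 : x ⬝ᵥ (fun _ => (1 : ℝ)) = ∑ v, x v := by simp [dotProduct]
    have h2 : (fun _ => (1 : ℝ)) ⬝ᵥ x = ∑ v, x v := by simp [dotProduct]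
    have h3 : (fun _ : V => (1 : ℝ)) ⬝ᵥ (fun _ => (1 : ℝ)) = Fintype.card V := by
      simp [dotProduct]
    rw [hy, sub_dotProduct, dotProduct_sub, dotProduct_sub, smul_dotProduct, smul_dotProduct,
      dotProduct_smul, dotProduct_smul, h1, h2, h3, hm]
    simp only [smul_eq_mul]
    field_simp
    ring
  have hyL : y ⬝ᵥ (G.lapMatrix ℝ *ᵥ x) = x ⬝ᵥ (G.lapMatrix ℝ *ᵥ x) := by
    rw [lapMatrix_dotProduct_comm, hLy, ← lapMatrix_dotProduct_comm]
  rw [← hyy, ← hyL, ← hLy, ← sum_eigenvectorBasis_mul hM y y,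
    ← sum_eigenvectorBasis_mul hM y (G.lapMatrix ℝ *ᵥ y),
    ← sum_eigenvectorBasis_mul hM (G.lapMatrix ℝ *ᵥ y) (G.lapMatrix ℝ *ᵥ y),
    Finset.mul_sum, Finset.mul_sum, Finset.mul_sum, ← Finset.sum_add_distrib,
    ← Finset.sum_add_distrib]
  refine Finset.sum_nonneg fun i _ => ?_
  rw [eigenvectorBasis_dotProduct_mulVec hM]
  rcases dotProduct_eq_zero_or_lapEigenvalue_two_le G hn hsum i with h0 | h2
  · rw [h0]
    simp
  · have := mul_nonneg (h _ h2 (eigenvalues_le_lapEigenvalue_card G i))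
      (sq_nonneg (⇑(hM.eigenvectorBasis i) ⬝ᵥ y))
    linarith

/-- The variational lower bound given by `μ₂`. -/
theorem lapEigenvalue_two_mul_le (hn : 2 ≤ Fintype.card V) (x : V → ℝ) :
    lapEigenvalue G 2 * (x ⬝ᵥ x - (∑ v, x v) ^ 2 / Fintype.card V)
      ≤ x ⬝ᵥ (G.lapMatrix ℝ *ᵥ x) := by
  have := lapMatrix_polynomial_nonneg G hn (p := -lapEigenvalue G 2) (q := 1) (r := 0)
    (fun t h _ => by linarith) x
  linarith

/-- The variational upper bound given by `μₙ`. -/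
theorem le_lapEigenvalue_card_mul (hn : 2 ≤ Fintype.card V) (x : V → ℝ) :
    x ⬝ᵥ (G.lapMatrix ℝ *ᵥ x)
      ≤ lapEigenvalue G (Fintype.card V) * (x ⬝ᵥ x - (∑ v, x v) ^ 2 / Fintype.card V) := by
  have := lapMatrix_polynomial_nonneg G hn (p := lapEigenvalue G (Fintype.card V)) (q := -1)
    (r := 0) (fun t _ h => by linarith) x
  linarith

/-- The quadratic inequality `(μₙ - L) (L - μ₂) ≥ 0` on vectors with zero sum. -/
theorem lapMatrix_mulVec_sq_le (hn : 2 ≤ Fintype.card V) (x : V → ℝ) :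
    (G.lapMatrix ℝ *ᵥ x) ⬝ᵥ (G.lapMatrix ℝ *ᵥ x)
        + lapEigenvalue G (Fintype.card V) * lapEigenvalue G 2
          * (x ⬝ᵥ x - (∑ v, x v) ^ 2 / Fintype.card V)
      ≤ (lapEigenvalue G (Fintype.card V) + lapEigenvalue G 2)
          * (x ⬝ᵥ (G.lapMatrix ℝ *ᵥ x)) := by
  have := lapMatrix_polynomial_nonneg G hn
    (p := -(lapEigenvalue G (Fintype.card V) * lapEigenvalue G 2))
    (q := lapEigenvalue G (Fintype.card V) + lapEigenvalue G 2) (r := -1)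
    (fun t h h' => by nlinarith [mul_nonneg (sub_nonneg.2 h) (sub_nonneg.2 h')]) x
  linarith

/-! ### Indicator vectors and edge cuts. -/

/-- The real characteristic vector of a finite set. -/
def indVec (A : Finset V) : V → ℝ := fun v => if v ∈ A then 1 else 0

/-- The Laplacian quadratic form of the characteristic vector of `A`, which is the number of edges
leaving `A`. -/
noncomputable def cutForm (A : Finset V) : ℝ := indVec A ⬝ᵥ (G.lapMatrix ℝ *ᵥ indVec A)

omit [Fintype V] in
theorem indVec_of_mem {A : Finset V} {v : V} (h : v ∈ A) : indVec A v = 1 := if_pos h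

omit [Fintype V] in
theorem indVec_of_notMem {A : Finset V} {v : V} (h : v ∉ A) : indVec A v = 0 := if_neg h

theorem indVec_dotProduct (A : Finset V) (f : V → ℝ) : indVec A ⬝ᵥ f = ∑ v ∈ A, f v := by
  simp [dotProduct, indVec]

theorem sum_indVec (A : Finset V) : ∑ v, indVec A v = #A := by
  simp [indVec]

theorem indVec_dotProduct_self (A : Finset V) : indVec A ⬝ᵥ indVec A = #A := by
  rw [indVec_dotProduct, sum_congr rfl fun v hv => indVec_of_mem hv]
  simp

theorem lapMatrix_mulVec_indVec_apply (A : Finset V) (v : V) :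
    (G.lapMatrix ℝ *ᵥ indVec A) v = G.degree v * indVec A v - #(G.neighborFinset v ∩ A) := by
  rw [G.lapMatrix_mulVec_apply]
  congr 1
  simp [indVec]

theorem lapMatrix_mulVec_indVec_of_mem {A : Finset V} {v : V} (hv : v ∈ A) :
    (G.lapMatrix ℝ *ᵥ indVec A) v = #(G.neighborFinset v \ A) := by
  rw [lapMatrix_mulVec_indVec_apply, indVec_of_mem hv, mul_one, ← G.card_neighborFinset_eq_degree,
    ← card_sdiff_add_card_inter (G.neighborFinset v) A]
  push_cast
  ring

theorem lapMatrix_mulVec_indVec_eq_zero {A : Finset V} {v : V} (hv : v ∉ A)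
    (h : ∀ u ∈ A, ¬ G.Adj u v) : (G.lapMatrix ℝ *ᵥ indVec A) v = 0 := by
  rw [lapMatrix_mulVec_indVec_apply, indVec_of_notMem hv, mul_zero, zero_sub, neg_eq_zero,
    Nat.cast_eq_zero, card_eq_zero, ← disjoint_iff_inter_eq_empty, disjoint_right]
  intro u hu hv'
  exact h u hu ((G.mem_neighborFinset v u).1 hv').symm

theorem cutForm_eq_sum (A : Finset V) :
    cutForm G A = ∑ u ∈ A, (#(G.neighborFinset u \ A) : ℝ) := by
  rw [cutForm, indVec_dotProduct]
  exact sum_congr rfl fun u hu => lapMatrix_mulVec_indVec_of_mem G hu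

theorem cutForm_le_lapEigenvalue_card_mul (hn : 2 ≤ Fintype.card V) (A : Finset V) :
    cutForm G A ≤ lapEigenvalue G (Fintype.card V) * (#A - (#A : ℝ) ^ 2 / Fintype.card V) := by
  simpa only [indVec_dotProduct_self, sum_indVec, cutForm] using le_lapEigenvalue_card_mul G hn (indVec A)

variable {G}

theorem cutForm_le_card_mul_card {A S : Finset V}
    (hS : ∀ u ∈ A, ∀ w, G.Adj u w → w ∈ A ∨ w ∈ S) : cutForm G A ≤ #A * #S := by
  rw [cutForm_eq_sum, ← nsmul_eq_mul]
  refine sum_le_card_nsmul _ _ _ fun u hu => ?_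
  exact_mod_cast card_le_card fun w hw => by
    rw [mem_sdiff, G.mem_neighborFinset] at hw
    exact (hS u hu w hw.1).resolve_left hw.2

/-- A vertex of `A` has at most |A| - 1 neighbours inside `A`. The bound is over the reals, so it
may be negative. -/
theorem card_mul_le_cutForm (A : Finset V) :
    (#A : ℝ) * (G.minDegree + 1 - #A) ≤ cutForm G A := by
  rw [cutForm_eq_sum, ← nsmul_eq_mul]
  refine card_nsmul_le_sum _ _ _ fun u hu => ?_
  have h1 : #(G.neighborFinset u ∩ A) ≤ #(A.erase u) := card_le_card fun w hw => by
    rw [mem_inter, G.mem_neighborFinset] at hw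
    exact mem_erase.2 ⟨hw.1.ne', hw.2⟩
  have h2 := card_sdiff_add_card_inter (G.neighborFinset u) A
  have h3 := card_erase_add_one hu
  have h4 := G.minDegree_le_degree u
  rw [← G.card_neighborFinset_eq_degree] at h4
  have h5 : G.minDegree + 1 ≤ #(G.neighborFinset u \ A) + #A := by omega
  have h6 : (G.minDegree : ℝ) + 1 ≤ #(G.neighborFinset u \ A) + #A := by exact_mod_cast h5
  linarith

theorem minDegree_mul_card_le_cutForm {I : Finset V} (hI : ∀ u ∈ I, ∀ w ∈ I, ¬ G.Adj u w) :
    (#I : ℝ) * G.minDegree ≤ cutForm G I := by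
  rw [cutForm_eq_sum, ← nsmul_eq_mul]
  refine card_nsmul_le_sum _ _ _ fun u hu => ?_
  rw [sdiff_eq_self_of_disjoint, G.card_neighborFinset_eq_degree]
  · exact_mod_cast G.minDegree_le_degree u
  · exact disjoint_left.2 fun w hw hw' => hI u hu w hw' ((G.mem_neighborFinset u w).1 hw)

theorem indVec_dotProduct_lapMatrix_mulVec_eq_zero {A B : Finset V} (hAB : Disjoint A B)
    (h : ∀ u ∈ A, ∀ w ∈ B, ¬ G.Adj u w) : indVec A ⬝ᵥ (G.lapMatrix ℝ *ᵥ indVec B) = 0 := by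
  rw [indVec_dotProduct]
  refine sum_eq_zero fun v hv => ?_
  exact lapMatrix_mulVec_indVec_eq_zero G (disjoint_left.1 hAB hv) fun u hu hadj =>
    h v hv u hu hadj.symm

theorem cutForm_union {A B : Finset V} (hAB : Disjoint A B)
    (h : ∀ u ∈ A, ∀ w ∈ B, ¬ G.Adj u w) : cutForm G (A ∪ B) = cutForm G A + cutForm G B := by
  have hind : indVec (A ∪ B) = indVec A + indVec B := by
    ext v
    by_cases hA : v ∈ A
    · simp [indVec, hA, disjoint_left.1 hAB hA]
    · simp [indVec, hA]
  have h0 := indVec_dotProduct_lapMatrix_mulVec_eq_zero hAB h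
  have h1 : indVec B ⬝ᵥ (G.lapMatrix ℝ *ᵥ indVec A) = 0 :=
    indVec_dotProduct_lapMatrix_mulVec_eq_zero hAB.symm fun u hu w hw hadj => h w hw u hu hadj.symm
  rw [cutForm, hind, mulVec_add, add_dotProduct, dotProduct_add, dotProduct_add, h0, h1]
  simp [cutForm]

/-- Rayleigh quotient of the zero-sum vector |B| 1_A - |A| 1_B; the cross terms vanish because no
edge joins `A` to `B`. -/
theorem lapEigenvalue_two_mul_le_of_not_adj (hn : 2 ≤ Fintype.card V) {A B : Finset V}
    (hAB : Disjoint A B) (h : ∀ u ∈ A, ∀ w ∈ B, ¬ G.Adj u w) :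
    lapEigenvalue G 2 * (#A * #B * (#A + #B))
      ≤ (#B : ℝ) ^ 2 * cutForm G A + (#A : ℝ) ^ 2 * cutForm G B := by
  have h0 := indVec_dotProduct_lapMatrix_mulVec_eq_zero hAB h
  have h1 : indVec B ⬝ᵥ (G.lapMatrix ℝ *ᵥ indVec A) = 0 :=
    indVec_dotProduct_lapMatrix_mulVec_eq_zero hAB.symm fun u hu w hw hadj => h w hw u hu hadj.symm
  have hB0 : indVec A ⬝ᵥ indVec B = 0 := by
    rw [indVec_dotProduct]
    exact sum_eq_zero fun v hv => indVec_of_notMem (disjoint_left.1 hAB hv)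
  have key := lapEigenvalue_two_mul_le G hn ((#B : ℝ) • indVec A - (#A : ℝ) • indVec B)
  have hsum : ∑ v, ((#B : ℝ) • indVec A - (#A : ℝ) • indVec B) v = 0 := by
    simp only [Pi.sub_apply, Pi.smul_apply, smul_eq_mul, sum_sub_distrib, ← mul_sum, sum_indVec]
    ring
  rw [hsum, mulVec_sub, mulVec_smul, mulVec_smul] at key
  simp only [sub_dotProduct, dotProduct_sub, smul_dotProduct, dotProduct_smul, h0, h1, hB0,
    dotProduct_comm (indVec B) (indVec A), indVec_dotProduct_self, smul_eq_mul, zero_pow two_ne_zero, zero_div] at key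
  rw [← cutForm, ← cutForm] at key
  linarith

/-- A vertex cut `S` separating `A` and `B` has at least `μ₂` vertices. -/
theorem lapEigenvalue_two_le_card_of_cut (hn : 2 ≤ Fintype.card V) {A B S : Finset V}
    (hA : A.Nonempty) (hB : B.Nonempty) (hAB : Disjoint A B)
    (h : ∀ u ∈ A, ∀ w ∈ B, ¬ G.Adj u w) (hcover : ∀ v, v ∈ A ∨ v ∈ B ∨ v ∈ S) :
    lapEigenvalue G 2 ≤ #S := by
  have hA' : (0 : ℝ) < #A := by exact_mod_cast hA.card_pos
  have hB' : (0 : ℝ) < #B := by exact_mod_cast hB.card_pos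
  have h1 := lapEigenvalue_two_mul_le_of_not_adj hn hAB h
  have h2 : cutForm G A ≤ #A * #S := cutForm_le_card_mul_card fun u hu w hadj => by
    have := h u hu w
    have := hcover w
    tauto
  have h3 : cutForm G B ≤ #B * #S := cutForm_le_card_mul_card fun u hu w hadj => by
    have := fun hw => h w hw u hu hadj.symm
    have := hcover w
    tauto
  have h4 := mul_le_mul_of_nonneg_left h2 (sq_nonneg (#B : ℝ))
  have h5 := mul_le_mul_of_nonneg_left h3 (sq_nonneg (#A : ℝ))
  refine le_of_mul_le_mul_right ?_ (by positivity : (0 : ℝ) < #A * #B * (#A + #B))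
  linarith

/-- The vector y = L 1_A lives on `A ∪ S`, with sum e(A) on `A` and -e(A) on `S`. Cauchy–Schwarz on
each piece gives |y|² ≥ e(A)²/|A| + e(A)²/|S|, and `lapMatrix_mulVec_sq_le` bounds |y|² from above.
-/
theorem cutForm_sq_le (hn : 2 ≤ Fintype.card V) {A S : Finset V} (hAS : Disjoint A S)
    (hS : ∀ u ∈ A, ∀ w, G.Adj u w → w ∈ A ∨ w ∈ S) :
    (#A + #S) * cutForm G A ^ 2 ≤ #A * #S *
      ((lapEigenvalue G (Fintype.card V) + lapEigenvalue G 2) * cutForm G A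
        - lapEigenvalue G (Fintype.card V) * lapEigenvalue G 2
          * (#A - (#A : ℝ) ^ 2 / Fintype.card V)) := by
  set y := G.lapMatrix ℝ *ᵥ indVec A with hy
  have hzero : ∀ v ∉ A ∪ S, y v = 0 := fun v hv => by
    rw [mem_union, not_or] at hv
    refine lapMatrix_mulVec_indVec_eq_zero G hv.1 fun u hu hadj => ?_
    have := hS u hu v hadj
    tauto
  have hA : ∑ v ∈ A, y v = cutForm G A := by rw [cutForm, indVec_dotProduct]
  have htot : ∑ v, y v = 0 := by
    have : (fun _ => (1 : ℝ)) ⬝ᵥ y = 0 := by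
      rw [hy, lapMatrix_dotProduct_comm, G.lapMatrix_mulVec_const_eq_zero, zero_dotProduct]
    simpa [dotProduct] using this
  have hsplit : ∀ f : ℝ → ℝ, f 0 = 0 →
      ∑ v, f (y v) = ∑ v ∈ A, f (y v) + ∑ v ∈ S, f (y v) := fun f hf => by
    rw [← sum_union hAS]
    exact (sum_subset (subset_univ _) fun v _ hv => by rw [hzero v hv, hf]).symm
  have hSsum : ∑ v ∈ S, y v = -cutForm G A := by
    have := hsplit id rfl
    simp only [id, htot, hA] at this
    linarith
  have hsq : y ⬝ᵥ y = ∑ v ∈ A, y v ^ 2 + ∑ v ∈ S, y v ^ 2 := by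
    rw [← hsplit (· ^ 2) (by simp), dotProduct]
    exact sum_congr rfl fun v _ => (sq (y v)).symm
  have hcA := sq_sum_le_card_mul_sum_sq (s := A) (f := y)
  have hcS := sq_sum_le_card_mul_sum_sq (s := S) (f := y)
  rw [hA] at hcA
  rw [hSsum, neg_sq] at hcS
  have key := lapMatrix_mulVec_sq_le G hn (indVec A)
  rw [← hy, hsq, indVec_dotProduct_self, sum_indVec, hy, ← cutForm, ← hy] at key
  have h1 := mul_le_mul_of_nonneg_left hcA (Nat.cast_nonneg #S : (0 : ℝ) ≤ #S)
  have h2 := mul_le_mul_of_nonneg_left hcS (Nat.cast_nonneg #A : (0 : ℝ) ≤ #A)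
  have h3 := mul_le_mul_of_nonneg_left key (by positivity : (0 : ℝ) ≤ #A * #S)
  linarith

/-- A graph with at least one edge has `μₙ ≥ d + 1` for every positive degree `d`. -/
theorem degree_add_one_le_lapEigenvalue_card (hn : 2 ≤ Fintype.card V) {v : V}
    (hv : 0 < G.degree v) : (G.degree v : ℝ) + 1 ≤ lapEigenvalue G (Fintype.card V) := by
  have hd : (0 : ℝ) < G.degree v := by exact_mod_cast hv
  have hn' : (0 : ℝ) < Fintype.card V := by exact_mod_cast (by omega : 0 < Fintype.card V)
  have hcut : cutForm G {v} = G.degree v := by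
    rw [cutForm_eq_sum, sum_singleton, sdiff_singleton_eq_erase, erase_eq_of_notMem (G.notMem_neighborFinset_self v),
      G.card_neighborFinset_eq_degree]
  have h1 := cutForm_le_lapEigenvalue_card_mul G hn {v}
  have h2 := cutForm_sq_le hn (A := {v}) (S := G.neighborFinset v) (G := G)
    (by simp) (fun u hu w h => by
      rw [mem_singleton] at hu
      subst hu
      exact .inr ((G.mem_neighborFinset u w).2 h))
  rw [hcut, card_singleton] at h1 h2
  rw [G.card_neighborFinset_eq_degree] at h2
  push_cast at h1 h2
  -- This nonnegative quantity collects all the μ₂ terms of `h2`; dropping it leaves d²(d + 1) ≤ d²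
  -- μₙ.
  have h3 : 0 ≤ lapEigenvalue G 2 * (lapEigenvalue G (Fintype.card V)
      * (1 - 1 ^ 2 / Fintype.card V) - G.degree v) :=
    mul_nonneg (lapEigenvalue_nonneg G 2) (by linarith)
  have h4 : (G.degree v : ℝ) * G.degree v * (G.degree v + 1)
      ≤ G.degree v * G.degree v * lapEigenvalue G (Fintype.card V) := by
    nlinarith [mul_nonneg hd.le h3]
  exact le_of_mul_le_mul_left h4 (by positivity)

theorem minDegree_add_one_le_lapEigenvalue_card (hE : G.edgeSet.Nonempty) :
    (G.minDegree : ℝ) + 1 ≤ lapEigenvalue G (Fintype.card V) := by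
  obtain ⟨e, he⟩ := hE
  induction e with | _ u w
  rw [SimpleGraph.mem_edgeSet] at he
  have hn : 2 ≤ Fintype.card V := Fintype.one_lt_card_iff.2 ⟨u, w, he.ne⟩
  refine le_trans ?_ (degree_add_one_le_lapEigenvalue_card hn
    ((G.degree_pos_iff_exists_adj u).2 ⟨w, he⟩))
  have : (G.minDegree : ℝ) ≤ G.degree u := by exact_mod_cast G.minDegree_le_degree u
  linarith

/-- The bound `c ≤ n (μₙ - δ) / μₙ` for an independent set of size `c`. -/
theorem card_mul_lapEigenvalue_card_le (hn : 2 ≤ Fintype.card V) {I : Finset V}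
    (hI : ∀ u ∈ I, ∀ w ∈ I, ¬ G.Adj u w) (hne : I.Nonempty) :
    (#I : ℝ) * lapEigenvalue G (Fintype.card V)
      ≤ Fintype.card V * (lapEigenvalue G (Fintype.card V) - G.minDegree) := by
  have hn' : (0 : ℝ) < Fintype.card V := by exact_mod_cast (by omega : 0 < Fintype.card V)
  have hI' : (0 : ℝ) < #I := by exact_mod_cast hne.card_pos
  -- Independence sends every edge at `I` outwards, so δ|I| ≤ e(I) ≤ μₙ |I| (1 - |I|/n).
  have h1 := (minDegree_mul_card_le_cutForm hI).trans (cutForm_le_lapEigenvalue_card_mul G hn I)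
  have h2 : lapEigenvalue G (Fintype.card V) * (#I - (#I : ℝ) ^ 2 / Fintype.card V)
      = #I * (lapEigenvalue G (Fintype.card V) * (1 - #I / Fintype.card V)) := by ring
  rw [h2] at h1
  have h3 := mul_le_mul_of_nonneg_left (le_of_mul_le_mul_left h1 hI') hn'.le
  have h4 : (Fintype.card V : ℝ) * (lapEigenvalue G (Fintype.card V) * (1 - #I / Fintype.card V))
      = lapEigenvalue G (Fintype.card V) * (Fintype.card V - #I) := by
    field_simp
  linarith

end LaplacianToughness

namespace LaplacianToughness

open Matrix Finset

/-! ### Inequalities for vertex cuts and for the extreme eigenvalues. -/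

/-- The numerical contradiction behind `two_mul_lapEigenvalue_two_le_of_cut`. -/
theorem cut_inequalities_false {a s n e M m δ : ℝ} (ha : 1 ≤ a) (hs : 0 ≤ s) (hn : 0 < n)
    (hθ : δ + 1 ≤ M) (hle : e ≤ a * s) (hge : a * (δ + 1 - a) ≤ e)
    (hsq : (a + s) * e ^ 2 ≤ a * s * ((M + m) * e - M * m * (a - a ^ 2 / n)))
    (hind : 2 * M ≤ n * (M - δ)) (hm : s * (M - δ) < 2 * m) (hme : m * a ≤ e) : False := by
  have ha0 : 0 < a := by linarith
  obtain ⟨θ, rfl⟩ : ∃ θ, M = δ + θ := ⟨M - δ, by ring⟩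
  simp only [add_sub_cancel_left] at hind hm
  have hθ1 : 1 ≤ θ := by linarith
  have hm0 : 0 < m := by nlinarith [mul_nonneg hs (by linarith : (0 : ℝ) ≤ θ)]
  have hs0 : 0 < s := by
    refine hs.lt_of_ne fun h => ?_
    subst h
    nlinarith [mul_pos hm0 ha0]
  -- Here τ is the edge density between the side and the cut. The hypotheses place `m` in (sθ/2,
  -- sτ].
  obtain ⟨τ, rfl⟩ : ∃ τ, e = a * s * τ := ⟨e / (a * s), by field_simp⟩
  obtain ⟨ν, rfl⟩ : ∃ ν, n = ν⁻¹ := ⟨n⁻¹, by simp⟩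
  have hν : 0 < ν := inv_pos.1 hn
  have hmτ : m ≤ s * τ := le_of_mul_le_mul_right (by linarith) ha0
  have hτθ : θ / 2 < τ := lt_of_mul_lt_mul_left (by linarith) hs
  have hge' : δ + 1 - a ≤ s * τ := le_of_mul_le_mul_left (by linarith) ha0
  have hMν : (δ + θ) * ν ≤ θ / 2 := by
    have := mul_le_mul_of_nonneg_right hind hν.le
    rw [mul_assoc, mul_comm ν⁻¹, mul_assoc θ, inv_mul_cancel₀ hν.ne'] at this
    linarith
  -- The left side is affine in `m`. It is positive at m = sτ (`hright`) and nonnegative at m = sθ/2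
  -- (`hleft`), hence positive at the actual `m`.
  have hg : (a + s) * s * τ ^ 2 - (δ + θ + m) * (s * τ) + (δ + θ) * m * (1 - a * ν) ≤ 0 := by
    rw [div_inv_eq_mul] at hsq
    refine le_of_mul_le_mul_left ?_ (by positivity : 0 < a ^ 2 * s)
    linarith
  have hright : 0 < a * s * τ * (τ - (δ + θ) * ν) := by
    have : 0 < τ - (δ + θ) * ν := by linarith
    have : 0 < τ := by linarith
    positivity
  -- Replacing sτ by its lower bound δ + 1 - a leaves exactly a(τ - θ/2) + (a - 1)(θ - 1).
  have hK : 0 ≤ τ * (a + s) - (δ + θ) + θ / 2 * a := by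
    have h1 : 0 ≤ a * (τ - θ / 2) := mul_nonneg ha0.le (by linarith)
    have h2 : 0 ≤ (a - 1) * (θ - 1) := mul_nonneg (by linarith) (by linarith)
    linarith
  have hleft : 0 ≤ s * ((τ - θ / 2) * (τ * (a + s) - (δ + θ) + θ / 2 * a)
      + θ / 2 * a * (θ / 2 - (δ + θ) * ν)) := by
    have h1 := mul_nonneg (by linarith : 0 ≤ τ - θ / 2) hK
    have h2 := mul_nonneg (by positivity : 0 ≤ θ / 2 * a) (sub_nonneg.2 hMν)
    positivity
  -- The sign of the slope decides which endpoint to compare with.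
  rcases lt_or_ge 0 ((δ + θ) * (1 - a * ν) - s * τ) with hD | hD
  · have := mul_pos (by linarith : 0 < m - s * θ / 2) hD
    linarith
  · have := mul_nonneg_of_nonpos_of_nonpos hD (by linarith : m - s * τ ≤ 0)
    linarith

variable {V : Type*} [Fintype V] [DecidableEq V] {G : SimpleGraph V} [DecidableRel G.Adj]

/-- A vertex cut `S` satisfies `|S| (μₙ - δ) ≥ 2 μ₂`. -/
theorem two_mul_lapEigenvalue_two_le_of_cut (hE : G.edgeSet.Nonempty) (hn : 2 ≤ Fintype.card V)
    {A B S : Finset V} (hA : A.Nonempty) (hB : B.Nonempty) (hAB : Disjoint A B)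
    (hAS : Disjoint A S) (hBS : Disjoint B S)
    (h : ∀ u ∈ A, ∀ w ∈ B, ¬ G.Adj u w) (hcover : ∀ v, v ∈ A ∨ v ∈ B ∨ v ∈ S) :
    2 * lapEigenvalue G 2 ≤ #S * (lapEigenvalue G (Fintype.card V) - G.minDegree) := by
  by_contra! hm
  have hn' : (0 : ℝ) < Fintype.card V := by exact_mod_cast (by omega : 0 < Fintype.card V)
  have hA' : (1 : ℝ) ≤ #A := by exact_mod_cast hA.card_pos
  have hB' : (1 : ℝ) ≤ #B := by exact_mod_cast hB.card_pos
  -- Hoffman bound for an independent pair with one vertex on each side.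
  have hind : 2 * lapEigenvalue G (Fintype.card V)
      ≤ Fintype.card V * (lapEigenvalue G (Fintype.card V) - G.minDegree) := by
    obtain ⟨u, hu⟩ := hA
    obtain ⟨w, hw⟩ := hB
    have hne : u ≠ w := fun he => disjoint_left.1 hAB hu (he ▸ hw)
    have := card_mul_lapEigenvalue_card_le (G := G) hn (I := {u, w}) (by
      have h1 := h u hu w hw
      have h2 : ¬ G.Adj w u := fun h' => h1 h'.symm
      simp [h1, h2]) ⟨u, by simp⟩
    rw [card_pair hne] at this
    exact_mod_cast this
  have hAS' : ∀ u ∈ A, ∀ w, G.Adj u w → w ∈ A ∨ w ∈ S := fun u hu w hadj => by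
    have := h u hu w
    have := hcover w
    tauto
  have hBS' : ∀ u ∈ B, ∀ w, G.Adj u w → w ∈ B ∨ w ∈ S := fun u hu w hadj => by
    have := fun hw => h w hw u hu hadj.symm
    have := hcover w
    tauto
  have hside : ∀ C : Finset V, (1 : ℝ) ≤ #C → Disjoint C S →
      (∀ u ∈ C, ∀ w, G.Adj u w → w ∈ C ∨ w ∈ S) →
      cutForm G C < lapEigenvalue G 2 * #C := fun C hC hCS hCS' => by
    by_contra! hme
    exact cut_inequalities_false hC (Nat.cast_nonneg _) hn'
      (minDegree_add_one_le_lapEigenvalue_card hE) (cutForm_le_card_mul_card hCS')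
      (card_mul_le_cutForm C) (cutForm_sq_le hn hCS hCS') hind hm hme
  have h1 := mul_lt_mul_of_pos_left (hside A hA' hAS hAS') (by positivity : (0 : ℝ) < (#B : ℝ) ^ 2)
  have h2 := mul_lt_mul_of_pos_left (hside B hB' hBS hBS') (by positivity : (0 : ℝ) < (#A : ℝ) ^ 2)
  have h3 := lapEigenvalue_two_mul_le_of_not_adj hn hAB h
  linarith

/-- If a vertex cut `S` leaves two parts of the same size, then `|S| μₙ ≥ n μ₂`. -/
theorem lapEigenvalue_two_mul_card_le_of_balanced_cut (hn : 2 ≤ Fintype.card V)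
    {A B : Finset V} (hA : A.Nonempty) (hAB : Disjoint A B)
    (h : ∀ u ∈ A, ∀ w ∈ B, ¬ G.Adj u w) (hcard : #A = #B) :
    lapEigenvalue G 2 * Fintype.card V
      ≤ (Fintype.card V - 2 * #A) * lapEigenvalue G (Fintype.card V) := by
  have hn' : (0 : ℝ) < Fintype.card V := by exact_mod_cast (by omega : 0 < Fintype.card V)
  have hA' : (0 : ℝ) < #A := by exact_mod_cast hA.card_pos
  have h1 := lapEigenvalue_two_mul_le_of_not_adj hn hAB h
  have h2 := cutForm_le_lapEigenvalue_card_mul G hn (A ∪ B)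
  rw [cutForm_union hAB h, card_union_of_disjoint hAB, ← hcard] at h2
  push_cast at h2
  rw [← hcard] at h1
  -- The test vector bounds e(A) + e(B) from below; μₙ applied to the indicator of `A ∪ B` bounds it
  -- from above.
  have h3 : lapEigenvalue G 2 * (2 * #A) ≤ cutForm G A + cutForm G B :=
    le_of_mul_le_mul_left (by linarith) (by positivity : (0 : ℝ) < (#A : ℝ) ^ 2)
  have h4 := mul_le_mul_of_nonneg_left (h3.trans h2) hn'.le
  have h5 : (Fintype.card V : ℝ) * (lapEigenvalue G (Fintype.card V) *
      (#A + #A - ((#A : ℝ) + #A) ^ 2 / Fintype.card V)) = lapEigenvalue G (Fintype.card V) *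
      (2 * #A * (Fintype.card V - 2 * #A)) := by
    field_simp
    ring
  refine le_of_mul_le_mul_left ?_ (by positivity : (0 : ℝ) < 2 * #A)
  linarith

/-- A graph in which some two vertices are not adjacent has `μ₂ ≤ δ`. -/
theorem lapEigenvalue_two_le_minDegree {u w : V} (hne : u ≠ w) (huw : ¬ G.Adj u w) :
    lapEigenvalue G 2 ≤ G.minDegree := by
  have hn : 2 ≤ Fintype.card V := Fintype.one_lt_card_iff.2 ⟨u, w, hne⟩
  have : Nonempty V := ⟨u⟩
  obtain ⟨v, hv⟩ := G.exists_minimal_degree_vertex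
  -- Since `u` misses both itself and `w`, δ ≤ n - 2. Hence the neighbourhood of the minimum-degree
  -- vertex `v` is a cut of size δ.
  have hdeg : #(insert v (G.neighborFinset v)) < Fintype.card V := by
    have h1 : #(insert u (insert w (G.neighborFinset u))) ≤ Fintype.card V := card_le_univ _
    rw [card_insert_of_notMem (by simp [hne]), card_insert_of_notMem (by simpa using huw),
      G.card_neighborFinset_eq_degree] at h1
    have h2 := card_insert_le v (G.neighborFinset v)
    rw [G.card_neighborFinset_eq_degree] at h2
    have h3 := G.minDegree_le_degree u
    omega
  have hB : (insert v (G.neighborFinset v))ᶜ.Nonempty := by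
    rw [← card_pos, card_compl]
    omega
  have := lapEigenvalue_two_le_card_of_cut (G := G) hn (A := {v})
    (B := (insert v (G.neighborFinset v))ᶜ) (S := G.neighborFinset v) (by simp) hB
    (by simp) (fun x hx y hy hadj => by
      rw [mem_singleton] at hx
      subst hx
      simp [hadj] at hy) (fun x => by simp; tauto)
  rwa [G.card_neighborFinset_eq_degree, ← hv] at this

/-- If the complement of a graph is disconnected then `μₙ ≥ n`. -/
theorem card_le_lapEigenvalue_card (hn : 2 ≤ Fintype.card V) (hG : ¬ Gᶜ.Connected) :
    (Fintype.card V : ℝ) ≤ lapEigenvalue G (Fintype.card V) := by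
  classical
  have hn' : (0 : ℝ) < Fintype.card V := by exact_mod_cast (by omega : 0 < Fintype.card V)
  have : Nonempty V := Fintype.card_pos_iff.1 (by omega)
  have hpre : ¬ Gᶜ.Preconnected := fun h => hG ⟨h⟩
  simp only [SimpleGraph.Preconnected, not_forall] at hpre
  obtain ⟨u, w, huw⟩ := hpre
  set A : Finset V := univ.filter fun x => Gᶜ.Reachable u x with hAdef
  have hmem : ∀ x, x ∈ A ↔ Gᶜ.Reachable u x := fun x => by simp [hAdef]
  have hu : u ∈ A := (hmem u).2 (SimpleGraph.Reachable.refl u)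
  have hw : w ∈ Aᶜ := by rw [mem_compl, hmem]; exact huw
  -- A component of the complement is completely joined in `G` to the other vertices, so e(A) = |A|
  -- |Aᶜ|.
  have hadj : ∀ x ∈ A, ∀ y ∉ A, G.Adj x y := fun x hx y hy => by
    by_contra hxy
    refine hy ((hmem y).2 (((hmem x).1 hx).trans (SimpleGraph.Adj.reachable ?_)))
    exact (G.compl_adj x y).2 ⟨fun he => hy (he ▸ hx), hxy⟩
  have hcut : cutForm G A = #A * #Aᶜ := by
    rw [cutForm_eq_sum, ← nsmul_eq_mul]
    refine sum_eq_card_nsmul fun x hx => ?_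
    congr 2
    ext y
    have := hadj x hx y
    simp only [mem_sdiff, G.mem_neighborFinset, mem_compl]
    tauto
  have h1 := cutForm_le_lapEigenvalue_card_mul G hn A
  have hA : (0 : ℝ) < #A := by exact_mod_cast card_pos.2 ⟨u, hu⟩
  have hAc : (0 : ℝ) < #Aᶜ := by exact_mod_cast card_pos.2 ⟨w, hw⟩
  have hsum : (#A : ℝ) + #Aᶜ = Fintype.card V := by exact_mod_cast card_add_card_compl A
  have h2 : (Fintype.card V : ℝ) * (lapEigenvalue G (Fintype.card V)
      * (#A - (#A : ℝ) ^ 2 / Fintype.card V))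
      = lapEigenvalue G (Fintype.card V) * (#A * #Aᶜ) := by
    rw [show (#Aᶜ : ℝ) = Fintype.card V - #A by linarith]
    field_simp
  have h3 := mul_le_mul_of_nonneg_left h1 hn'.le
  rw [h2, hcut] at h3
  exact le_of_mul_le_mul_right h3 (by positivity)

theorem card_add_minDegree_le {I : Finset V} (hI : ∀ u ∈ I, ∀ w ∈ I, ¬ G.Adj u w)
    (hne : I.Nonempty) : #I + G.minDegree ≤ Fintype.card V := by
  obtain ⟨u, hu⟩ := hne
  have h1 : Disjoint I (G.neighborFinset u) :=
    disjoint_left.2 fun w hw hw' => hI u hu w hw ((G.mem_neighborFinset u w).1 hw')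
  have h2 := card_le_univ (I ∪ G.neighborFinset u)
  rw [card_union_of_disjoint h1, G.card_neighborFinset_eq_degree] at h2
  have := G.minDegree_le_degree u
  omega

end LaplacianToughness

namespace LaplacianToughness

open Matrix Finset

variable {V : Type*} [Fintype V] [DecidableEq V] {G : SimpleGraph V}

/-! ### Unions of components of `G - S` as vertex sets. -/

open Classical in
/-- The vertices of the components of `G - S` that belong to `K`. -/
noncomputable def componentUnion (S : Set V) (K : Set (deleteSet G S).ConnectedComponent) :
    Finset V :=
  univ.filter fun v => ∃ h : v ∈ Sᶜ, (deleteSet G S).connectedComponentMk ⟨v, h⟩ ∈ K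

omit [DecidableEq V] in
theorem mem_componentUnion {S : Set V} {K : Set (deleteSet G S).ConnectedComponent} {v : V} :
    v ∈ componentUnion S K ↔
      ∃ h : v ∈ Sᶜ, (deleteSet G S).connectedComponentMk ⟨v, h⟩ ∈ K := by
  simp [componentUnion]

omit [DecidableEq V] in
theorem disjoint_componentUnion_compl (S : Set V)
    (K : Set (deleteSet G S).ConnectedComponent) :
    Disjoint (componentUnion S K) (componentUnion S Kᶜ) := by
  refine disjoint_left.2 fun v hv hv' => ?_
  obtain ⟨h, hK⟩ := mem_componentUnion.1 hv
  obtain ⟨_, hK'⟩ := mem_componentUnion.1 hv'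
  exact hK' hK

omit [DecidableEq V] in
theorem notMem_of_mem_componentUnion {S : Set V} {K : Set (deleteSet G S).ConnectedComponent}
    {v : V} (hv : v ∈ componentUnion S K) : v ∉ S :=
  (mem_componentUnion.1 hv).1

omit [DecidableEq V] in
theorem not_adj_componentUnion_compl (S : Set V) (K : Set (deleteSet G S).ConnectedComponent) :
    ∀ u ∈ componentUnion S K, ∀ w ∈ componentUnion S Kᶜ, ¬ G.Adj u w := by
  intro u hu w hw hadj
  obtain ⟨h, hK⟩ := mem_componentUnion.1 hu
  obtain ⟨h', hK'⟩ := mem_componentUnion.1 hw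
  have h1 : (deleteSet G S).Adj ⟨u, h⟩ ⟨w, h'⟩ := hadj
  rw [SimpleGraph.ConnectedComponent.sound h1.reachable] at hK
  exact hK' hK

omit [DecidableEq V] in
theorem mem_componentUnion_or (S : Set V) (K : Set (deleteSet G S).ConnectedComponent) (v : V) :
    v ∈ componentUnion S K ∨ v ∈ componentUnion S Kᶜ ∨ v ∈ S := by
  by_cases hS : v ∈ S
  · exact .inr (.inr hS)
  by_cases hK : (deleteSet G S).connectedComponentMk ⟨v, hS⟩ ∈ K
  · exact .inl (mem_componentUnion.2 ⟨hS, hK⟩)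
  · exact .inr (.inl (mem_componentUnion.2 ⟨hS, hK⟩))

omit [DecidableEq V] in
theorem componentUnion_nonempty {S : Set V} {K : Set (deleteSet G S).ConnectedComponent}
    (hK : K.Nonempty) : (componentUnion S K).Nonempty := by
  obtain ⟨C, hC⟩ := hK
  obtain ⟨⟨v, hv⟩, rfl⟩ := C.exists_rep
  exact ⟨v, mem_componentUnion.2 ⟨hv, hC⟩⟩

omit [DecidableEq V] in
theorem card_componentUnion (S : Set V) (K : Set (deleteSet G S).ConnectedComponent) :
    #(componentUnion S K) = (⋃ C ∈ K, C.supp).ncard := by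
  rw [← Set.ncard_coe_finset, ← Set.ncard_image_of_injective _ Subtype.val_injective]
  congr 1
  ext v
  simp only [mem_coe, mem_componentUnion, Set.mem_image, Set.mem_iUnion,
    SimpleGraph.ConnectedComponent.mem_supp_iff, exists_prop, Subtype.exists, exists_and_right,
    exists_eq_right, exists_eq_right']

theorem card_componentUnion_add (S : Set V) (K : Set (deleteSet G S).ConnectedComponent) :
    #(componentUnion S K) + #(componentUnion S Kᶜ) + S.ncard = Fintype.card V := by
  classical
  have hS : Disjoint (componentUnion S K ∪ componentUnion S Kᶜ) S.toFinset := by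
    refine disjoint_left.2 fun v hv hv' => ?_
    rw [Set.mem_toFinset] at hv'
    rcases mem_union.1 hv with h | h <;> exact notMem_of_mem_componentUnion h hv'
  rw [← card_union_of_disjoint (disjoint_componentUnion_compl S K),
    Set.ncard_eq_toFinset_card', ← card_union_of_disjoint hS, ← card_univ]
  congr 1
  ext v
  have := mem_componentUnion_or S K v
  simp only [mem_union, Set.mem_toFinset, mem_univ, iff_true]
  tauto

/-- Choosing a vertex in each component of `G - S` gives an independent set. -/
theorem exists_independent_card_eq_numComponents (G : SimpleGraph V) (S : Set V) :
    ∃ I : Finset V, #I = numComponents G S ∧ (∀ u ∈ I, u ∉ S) ∧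
      ∀ u ∈ I, ∀ w ∈ I, ¬ G.Adj u w := by
  classical
  have hmk : ∀ C : (deleteSet G S).ConnectedComponent,
      (deleteSet G S).connectedComponentMk (Quot.out C) = C := fun C => Quot.out_eq C
  let f : (deleteSet G S).ConnectedComponent → V := fun C => (Quot.out C).1
  have hf : Function.Injective f := fun C D h => by
    rw [← hmk C, ← hmk D, Subtype.val_injective h]
  have := Fintype.ofFinite (deleteSet G S).ConnectedComponent
  refine ⟨univ.image f, ?_, ?_, ?_⟩
  · rw [card_image_of_injective _ hf, numComponents, Nat.card_eq_fintype_card, card_univ]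
  · intro u hu
    obtain ⟨C, -, rfl⟩ := mem_image.1 hu
    exact (Quot.out C).2
  · intro u hu w hw hadj
    obtain ⟨C, -, rfl⟩ := mem_image.1 hu
    obtain ⟨D, -, rfl⟩ := mem_image.1 hw
    have h1 : (deleteSet G S).Adj (Quot.out C) (Quot.out D) := hadj
    have h2 := SimpleGraph.ConnectedComponent.sound h1.reachable
    have h3 : C = D := by rw [← hmk C, ← hmk D]; exact h2
    exact G.ne_of_adj hadj (h3 ▸ rfl)

omit [DecidableEq V] in
theorem numComponents_pos (G : SimpleGraph V) {S : Set V} (hS : S ≠ Set.univ) :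
    0 < numComponents G S := by
  obtain ⟨v, hv⟩ := (Set.ne_univ_iff_exists_notMem S).1 hS
  have : Nonempty (deleteSet G S).ConnectedComponent :=
    ⟨(deleteSet G S).connectedComponentMk ⟨v, hv⟩⟩
  exact Nat.card_pos

omit [DecidableEq V] in
/-- A disconnecting set `S` leaves two nonempty unions of components. -/
theorem exists_nonempty_nonempty_compl {S : Set V} (hS : 1 < numComponents G S) :
    ∃ K : Set (deleteSet G S).ConnectedComponent, K.Nonempty ∧ Kᶜ.Nonempty := by
  have : Nontrivial (deleteSet G S).ConnectedComponent :=
    Finite.one_lt_card_iff_nontrivial.1 hS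
  obtain ⟨C, D, hCD⟩ := exists_pair_ne (deleteSet G S).ConnectedComponent
  exact ⟨{C}, ⟨C, rfl⟩, ⟨D, fun h => hCD h.symm⟩⟩

omit [DecidableEq V] [Fintype V] in
-- An empty infimum is ⊤, so finite toughness forces a disconnecting set.
theorem exists_one_lt_numComponents_of_toughness_eq {r : ℝ} (h : toughness G = (r : EReal)) :
    ∃ S : Set V, 1 < numComponents G S := by
  by_contra! hno
  have : IsEmpty {S : Set V // 1 < numComponents G S} := ⟨fun S => (hno S.1).not_gt S.2⟩
  rw [toughness, iInf_of_empty] at h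
  exact EReal.coe_ne_top r h.symm

/-! ### The four cases. -/

variable [DecidableRel G.Adj]

theorem lapEigenvalue_two_le_ncard (hn : 2 ≤ Fintype.card V) {S : Set V}
    (hS : 1 < numComponents G S) : lapEigenvalue G 2 ≤ S.ncard := by
  classical
  obtain ⟨K, hK, hK'⟩ := exists_nonempty_nonempty_compl hS
  rw [Set.ncard_eq_toFinset_card']
  exact lapEigenvalue_two_le_card_of_cut hn (componentUnion_nonempty hK)
    (componentUnion_nonempty hK') (disjoint_componentUnion_compl S K)
    (not_adj_componentUnion_compl S K) fun v => by simpa using mem_componentUnion_or S K v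

/-- The bound when the complement of the graph is disconnected. -/
theorem numComponents_mul_le_of_not_connected_compl (hn : 2 ≤ Fintype.card V)
    (hG : ¬ Gᶜ.Connected) {S : Set V} (hS : 1 < numComponents G S) :
    numComponents G S * lapEigenvalue G 2
      ≤ S.ncard * (lapEigenvalue G (Fintype.card V) - G.minDegree) := by
  obtain ⟨I, hI, -, hadj⟩ := exists_independent_card_eq_numComponents G S
  have h1 := card_add_minDegree_le hadj (card_pos.1 (by omega))
  rw [hI] at h1
  have h2 : (numComponents G S : ℝ) + G.minDegree ≤ Fintype.card V := by exact_mod_cast h1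
  have h3 := card_le_lapEigenvalue_card hn hG
  rw [mul_comm (S.ncard : ℝ)]
  -- Product of c ≤ n - δ ≤ μₙ - δ and μ₂ ≤ |S|.
  exact mul_le_mul (by linarith) (lapEigenvalue_two_le_ncard hn hS) (lapEigenvalue_nonneg G 2)
    (by linarith [(Nat.cast_nonneg _ : (0 : ℝ) ≤ numComponents G S)])

/-- The bound when all components of `G - S` are single vertices. -/
theorem numComponents_mul_le_of_forall_ncard_eq_one (hn : 2 ≤ Fintype.card V) {S : Set V}
    (hSuniv : S ≠ Set.univ) (hδ : lapEigenvalue G 2 ≤ G.minDegree)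
    (hS : ∀ C : (deleteSet G S).ConnectedComponent, C.supp.ncard = 1) :
    numComponents G S * lapEigenvalue G 2
      ≤ S.ncard * (lapEigenvalue G (Fintype.card V) - G.minDegree) := by
  classical
  set J : Finset V := S.toFinsetᶜ with hJdef
  have hmem : ∀ v, v ∈ J ↔ v ∉ S := fun v => by simp [hJdef]
  have hJ : ∀ u ∈ J, ∀ w ∈ J, ¬ G.Adj u w := by
    intro u hu w hw hadj
    rw [hmem] at hu hw
    have h1 : (deleteSet G S).Adj ⟨u, hu⟩ ⟨w, hw⟩ := hadj
    have h2 := SimpleGraph.ConnectedComponent.sound h1.reachable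
    obtain ⟨x, hx⟩ := Set.ncard_eq_one.1
      (hS ((deleteSet G S).connectedComponentMk ⟨u, hu⟩))
    have hux : (⟨u, hu⟩ : ↥(Sᶜ)) = x := by
      have : (⟨u, hu⟩ : ↥(Sᶜ)) ∈ ((deleteSet G S).connectedComponentMk ⟨u, hu⟩).supp := rfl
      rwa [hx] at this
    have hwx : (⟨w, hw⟩ : ↥(Sᶜ)) = x := by
      have : (⟨w, hw⟩ : ↥(Sᶜ)) ∈ ((deleteSet G S).connectedComponentMk ⟨u, hu⟩).supp := h2.symm
      rwa [hx] at this
    exact h1.ne (hux.trans hwx.symm)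
  have hJne : J.Nonempty := by
    obtain ⟨v, hv⟩ := (Set.ne_univ_iff_exists_notMem S).1 hSuniv
    exact ⟨v, (hmem v).2 hv⟩
  have hcard : (S.ncard : ℝ) + #J = Fintype.card V := by
    rw [Set.ncard_eq_toFinset_card']
    exact_mod_cast card_add_card_compl S.toFinset
  have hc : (numComponents G S : ℝ) ≤ #J := by
    obtain ⟨I, hI, hIS, -⟩ := exists_independent_card_eq_numComponents G S
    rw [← hI]
    exact_mod_cast card_le_card fun v hv => (hmem v).2 (hIS v hv)
  have h1 := card_mul_lapEigenvalue_card_le hn hJ hJne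
  have h2 : (numComponents G S : ℝ) * lapEigenvalue G 2 ≤ #J * G.minDegree :=
    mul_le_mul hc hδ (lapEigenvalue_nonneg G 2) (Nat.cast_nonneg _)
  -- With n = |S| + |J|, the Hoffman bound rearranges to |J| δ ≤ |S| (μₙ - δ).
  rw [← hcard] at h1
  linarith

/-- The bound when the components of `G - S` can be split into two halves of equal size. -/
theorem numComponents_mul_le_of_balanced (hn : 2 ≤ Fintype.card V) {S : Set V}
    (hSuniv : S ≠ Set.univ) {K : Set (deleteSet G S).ConnectedComponent}
    (hK : ((⋃ C ∈ K, C.supp).ncard : ℝ) = 1 / 2 * ((Fintype.card V : ℝ) - S.ncard)) :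
    numComponents G S * lapEigenvalue G 2
      ≤ S.ncard * (lapEigenvalue G (Fintype.card V) - G.minDegree) := by
  have hn' : (0 : ℝ) < Fintype.card V := by exact_mod_cast (by omega : 0 < Fintype.card V)
  rw [← card_componentUnion] at hK
  have hadd : (#(componentUnion S K) : ℝ) + #(componentUnion S Kᶜ) + S.ncard
      = Fintype.card V := by exact_mod_cast card_componentUnion_add S K
  have heq : #(componentUnion S K) = #(componentUnion S Kᶜ) := by
    have : (#(componentUnion S K) : ℝ) = #(componentUnion S Kᶜ) := by linarith
    exact_mod_cast this
  have hlt : S.ncard < Fintype.card V := by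
    rw [← Nat.card_eq_fintype_card]
    exact Set.ncard_lt_card hSuniv
  have hlt' : (S.ncard : ℝ) < Fintype.card V := by exact_mod_cast hlt
  have hne : (componentUnion S K).Nonempty := by
    rw [← card_pos]
    have : (0 : ℝ) < #(componentUnion S K) := by linarith
    exact_mod_cast this
  have h1 := lapEigenvalue_two_mul_card_le_of_balanced_cut hn hne
    (disjoint_componentUnion_compl S K) (not_adj_componentUnion_compl S K) heq
  rw [show (Fintype.card V : ℝ) - 2 * #(componentUnion S K) = S.ncard by linarith] at h1
  obtain ⟨I, hI, -, hadj⟩ := exists_independent_card_eq_numComponents G S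
  have hpos := numComponents_pos G hSuniv
  have h2 := card_mul_lapEigenvalue_card_le hn hadj (card_pos.1 (by omega))
  rw [hI] at h2
  -- The chain is n c μ₂ ≤ c |S| μₙ ≤ n |S| (μₙ - δ).
  have h3 := mul_le_mul_of_nonneg_left h1 (Nat.cast_nonneg (numComponents G S) : (0 : ℝ) ≤ _)
  have h4 := mul_le_mul_of_nonneg_left h2 (Nat.cast_nonneg S.ncard : (0 : ℝ) ≤ _)
  refine le_of_mul_le_mul_left ?_ hn'
  linarith

/-- The bound when `G - S` has two components. -/
theorem numComponents_mul_le_of_eq_two (hE : G.edgeSet.Nonempty) (hn : 2 ≤ Fintype.card V)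
    {S : Set V} (hS : numComponents G S = 2) :
    numComponents G S * lapEigenvalue G 2
      ≤ S.ncard * (lapEigenvalue G (Fintype.card V) - G.minDegree) := by
  classical
  obtain ⟨K, hK, hK'⟩ := exists_nonempty_nonempty_compl (by omega : 1 < numComponents G S)
  rw [hS, Set.ncard_eq_toFinset_card']
  have hdisj : ∀ K : Set (deleteSet G S).ConnectedComponent,
      Disjoint (componentUnion S K) S.toFinset := fun K =>
    disjoint_left.2 fun v hv hv' => notMem_of_mem_componentUnion hv (Set.mem_toFinset.1 hv')
  exact_mod_cast two_mul_lapEigenvalue_two_le_of_cut hE hn (componentUnion_nonempty hK)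
    (componentUnion_nonempty hK') (disjoint_componentUnion_compl S K) (hdisj K) (hdisj Kᶜ)
    (not_adj_componentUnion_compl S K) fun v => by simpa using mem_componentUnion_or S K v

end LaplacianToughness

/-! ### Assembly. -/

open LaplacianToughness in
theorem proposition1 {V : Type*} [Fintype V] [DecidableEq V] (G : SimpleGraph V)
    [DecidableRel G.Adj] (hE : G.edgeSet.Nonempty) :
    -- the denominator of the bound is positive
    (G.minDegree : ℝ) < LaplacianToughness.lapEigenvalue G (Fintype.card V) ∧
    -- (i) the complement of the graph is disconnected
    (¬ Gᶜ.Connected →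
      ((LaplacianToughness.lapEigenvalue G 2 /
        (LaplacianToughness.lapEigenvalue G (Fintype.card V) - (G.minDegree : ℝ)) : ℝ) : EReal)
          ≤ LaplacianToughness.toughness G) ∧
    ∀ S : Set V, S ≠ Set.univ →
      LaplacianToughness.toughness G =
        (((S.ncard : ℝ) / (LaplacianToughness.numComponents G S : ℝ) : ℝ) : EReal) →
      -- (ii) all components are singletons
      ((∀ C : (LaplacianToughness.deleteSet G S).ConnectedComponent, C.supp.ncard = 1) ∨
      -- (iii) some union of components contains exactly half of the vertices outside S
       (∃ K : Set (LaplacianToughness.deleteSet G S).ConnectedComponent,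
          ((⋃ C ∈ K, C.supp).ncard : ℝ) = 1 / 2 * ((Fintype.card V : ℝ) - (S.ncard : ℝ))) ∨
      -- (iv) there are exactly two components
       LaplacianToughness.numComponents G S = 2) →
      ((LaplacianToughness.lapEigenvalue G 2 /
        (LaplacianToughness.lapEigenvalue G (Fintype.card V) - (G.minDegree : ℝ)) : ℝ) : EReal)
          ≤ LaplacianToughness.toughness G := by
  have hδ := minDegree_add_one_le_lapEigenvalue_card hE
  have hpos : (0 : ℝ) < lapEigenvalue G (Fintype.card V) - G.minDegree := by linarith
  have hn : 2 ≤ Fintype.card V := by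
    obtain ⟨e, he⟩ := hE
    induction e with | _ u w
    exact Fintype.one_lt_card_iff.2 ⟨u, w, G.ne_of_adj he⟩
  have hdiv : ∀ S : Set V, 0 < numComponents G S →
      numComponents G S * lapEigenvalue G 2
        ≤ S.ncard * (lapEigenvalue G (Fintype.card V) - G.minDegree) →
      ((lapEigenvalue G 2 / (lapEigenvalue G (Fintype.card V) - G.minDegree) : ℝ) : EReal)
        ≤ (((S.ncard : ℝ) / (numComponents G S : ℝ) : ℝ) : EReal) := by
    intro S hc h
    have hc' : (0 : ℝ) < numComponents G S := by exact_mod_cast hc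
    rw [EReal.coe_le_coe_iff, div_le_div_iff₀ hpos hc']
    linarith
  refine ⟨by linarith, fun hG => ?_, fun S hS ht hcases => ?_⟩
  -- In case (i) the bound holds for every cut, so no minimizer is needed, and ⊤ is covered.
  · exact le_iInf fun S => hdiv S.1 (by have := S.2; omega)
      (numComponents_mul_le_of_not_connected_compl hn hG S.2)
  · rw [ht]
    refine hdiv S (numComponents_pos G hS) ?_
    rcases hcases with h | ⟨K, hK⟩ | h
    -- `S` itself is not assumed to disconnect `G`; the nonadjacent pair needed for μ₂ ≤ δ comes
    -- from another cut `T`.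
    · obtain ⟨T, hT⟩ := exists_one_lt_numComponents_of_toughness_eq ht
      obtain ⟨K, hK, hK'⟩ := exists_nonempty_nonempty_compl hT
      obtain ⟨u, hu⟩ := componentUnion_nonempty hK
      obtain ⟨w, hw⟩ := componentUnion_nonempty hK'
      exact numComponents_mul_le_of_forall_ncard_eq_one hn hS
        (lapEigenvalue_two_le_minDegree (u := u) (w := w)
          (fun he => Finset.disjoint_left.1 (disjoint_componentUnion_compl T K) hu (he ▸ hw))
          (not_adj_componentUnion_compl T K u hu w hw)) h
    · exact numComponents_mul_le_of_balanced hn hS hK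
    · exact numComponents_mul_le_of_eq_two hE hn h
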